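/- Let $\Omega\subset\mathbb R^3$ be a bounded domain with boundary of class $C^3$ (the cavity), filled with a fluid of density $1$, and let a rigid body occupy a bounded measurable set $\mathcal B\subset\mathbb R^3\setminus\Omega$ of positive volume with an integrable mass density $\varrho_{\mathcal B}>0$. Let $$\mathbb I=\int_\Omega\big(|x|^2 I_3-x\otimes x\big)\,dx+\int_{\mathcal B}\varrho_{\mathcal B}(x)\big(|x|^2 I_3-x\otimes x\big)\,dx$$ be the inertia tensor, with respect to the origin, of the whole system. Let $1<q<\infty$, let $$L_{q,\sigma}(\Omega)=\{v\in L_q(\Omega)^3:\ \operatorname{div} v=0 \text{ in }\Omega,\ (v|\nu)=0\text{ on }\partial\Omega\}$$ (in the weak sense: $\int_\Omega (v|\nabla\varphi)\,dx=0$ for all $\varphi\in W^1_{q'}(\Omega)$, $1/q+1/q'=1$), and let $\mathbb P$ be the Helmholtz projection of $L_q(\Omega)^3$ onto $L_{q,\sigma}(\Omega)$ along $\{\nabla p: p\in W^1_q(\Omega)\}$. On $X_0=L_{q,\sigma}(\Omega)\times\mathbb R^3$ consider the operator $$E(v,\mathsf a)=\Big(v+\mathbb P\Big(x\times\mathbb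 I^{-1}\int_\Omega x\times v\,dx\Big)-\mathbb P(x\times\mathsf a),\ \mathbb I\mathsf a\Big).$$ Then $E$ is invertible on $X_0$ (a bijection, bounded with bounded inverse), and there is a bounded linear operator $C$ on $L_{q,\sigma}(\Omega)$ such that $$E^{-1}=\begin{bmatrix} I+C & (I+C)\,\mathbb P(x\times\mathbb I^{-1}\,\cdot\,)\\ 0&\mathbb I^{-1}\end{bmatrix},$$ where $I$ is the identity on $L_{q,\sigma}(\Omega)$, and $C$ has the following properties. (a) $C$ is compact, and in fact of finite rank, on $L_{q,\sigma}(\Omega)$. (b) $I+C$ is invertible on $L_{q,\sigma}(\Omega)$ and positive definite on $L_{2,\sigma}(\Omega)$. The latter means: there is a bounded operator $C_2$ on $L_{2,\sigma}(\Omega)$ that agrees with $C$ on $L_{q,\sigma}(\Omega)\cap L_{2,\sigma}(\Omega)$ such that $I+C_2$ is symmetric with respect to the $L_2$ inner product and, for some $c>0$, $((I+C_2)v|v)_{L_2(\Omega)}\ge c\,|v|^2_{L_2(\Omega)}$ for all $v\in L_{2,\sigma}(\Omega)$. -/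

import Mathlib

open MeasureTheory
open scoped ENNReal ContDiff

/-- Euclidean space `ℝ³`. -/
abbrev E3 : Type := EuclideanSpace ℝ (Fin 3)

/-- The cross product `a × b` in `ℝ³`. -/
noncomputable def cross (a b : E3) : E3 :=
  WithLp.toLp 2 (crossProduct (WithLp.ofLp a) (WithLp.ofLp b))

/-- `Ω ⊆ ℝ³` is a bounded domain (nonempty, open, connected) with boundary of class `C³`:
near each boundary point, `Ω` is the set where a `C³` function with nonvanishing derivative is
negative. -/
structure IsBoundedC3Domain (Ω : Set E3) : Prop where
  isOpen : IsOpen Ω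
  isConnected : IsConnected Ω
  isBounded : Bornology.IsBounded Ω
  boundary : ∀ x₀ ∈ frontier Ω, ∃ (U : Set E3) (r : E3 → ℝ),
    IsOpen U ∧ x₀ ∈ U ∧ ContDiffOn ℝ 3 r U ∧ (∀ x ∈ U, fderiv ℝ r x ≠ 0) ∧
      Ω ∩ U = {x ∈ U | r x < 0}

/-- A solid body occupying the bounded region `B` of positive volume outside the cavity `Ω`,
with positive integrable mass density `ρ`. -/
structure IsSolidBody (Ω B : Set E3) (ρ : E3 → ℝ) : Prop where
  measurableSet : MeasurableSet B
  isBounded : Bornology.IsBounded B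
  volume_pos : 0 < volume B
  disjoint : Disjoint Ω B
  density_pos : ∀ x ∈ B, 0 < ρ x
  density_integrable : IntegrableOn ρ B volume

/-- The inertia tensor, with respect to the origin, of the whole system: the cavity `Ω` filled with
fluid of density `1`, and the solid in `B` of density `ρ`. -/
noncomputable def inertiaTensor (Ω B : Set E3) (ρ : E3 → ℝ) : Matrix (Fin 3) (Fin 3) ℝ :=
  Matrix.of fun i j =>
    (∫ x in Ω, ‖x‖ ^ 2 * (if i = j then 1 else 0) - x i * x j) +
      ∫ x in B, ρ x * (‖x‖ ^ 2 * (if i = j then 1 else 0) - x i * x j)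

/-- The action `a ↦ M a` of a matrix on a vector of `ℝ³`. -/
noncomputable def act (M : Matrix (Fin 3) (Fin 3) ℝ) (a : E3) : E3 :=
  WithLp.toLp 2 (M.mulVec (WithLp.ofLp a))

/-- The vector fields in `L_q(Ω)`. -/
noncomputable abbrev LqField (Ω : Set E3) (q : ℝ≥0∞) := Lp E3 q (volume.restrict Ω)

/-- `g` is the weak (distributional) gradient of `p` in `Ω`. -/
def IsWeakGradient (Ω : Set E3) (p : E3 → ℝ) (g : E3 → E3) : Prop :=
  ∀ ψ : E3 → ℝ, ContDiff ℝ ∞ ψ → HasCompactSupport ψ → tsupport ψ ⊆ Ω →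
    ∀ i : Fin 3, ∫ x in Ω, p x * fderiv ℝ ψ x (EuclideanSpace.single i 1) =
      -∫ x in Ω, g x i * ψ x

/-- `p` belongs to the Sobolev space `W¹_q(Ω)` and `g` is its gradient. -/
structure HasSobolevGradient (Ω : Set E3) (q : ℝ≥0∞) (p : E3 → ℝ) (g : E3 → E3) : Prop where
  memLp : MemLp p q (volume.restrict Ω)
  memLp_grad : MemLp g q (volume.restrict Ω)
  isWeakGradient : IsWeakGradient Ω p g

/-- `div v = 0` in `Ω` and `(v|ν) = 0` on `∂Ω`, for `v ∈ L_q(Ω)`, in the weak sense: by Green's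
formula `∫_Ω (v|∇φ) dx = ∫_∂Ω (v|ν) φ - ∫_Ω (div v) φ dx`, both hold together if and only if
`∫_Ω (v|∇φ) dx = 0` for every `φ ∈ W¹_{q'}(Ω)`, where `1/q + 1/q' = 1`. -/
def IsSolenoidal (Ω : Set E3) (q : ℝ≥0∞) (v : E3 → E3) : Prop :=
  ∀ q' : ℝ≥0∞, q.HolderConjugate q' → ∀ (φ : E3 → ℝ) (g : E3 → E3),
    HasSobolevGradient Ω q' φ g → ∫ x in Ω, inner ℝ (v x) (g x) = 0

theorem IsWeakGradient.congr {Ω : Set E3} {p : E3 → ℝ} {g h : E3 → E3}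
    (hp : IsWeakGradient Ω p g) (hgh : g =ᵐ[volume.restrict Ω] h) : IsWeakGradient Ω p h := by
  intro ψ h1 h2 h3 i
  rw [hp ψ h1 h2 h3 i]
  congr 1
  refine integral_congr_ae ?_
  filter_upwards [hgh] with x hx
  rw [hx]

theorem integrable_mul_test {Ω : Set E3} {q : ℝ≥0∞} (hq : 1 ≤ q) {p ψ : E3 → ℝ}
    (hp : MemLp p q (volume.restrict Ω)) (hψ : Continuous ψ) (hc : HasCompactSupport ψ) :
    Integrable (fun x => p x * ψ x) (volume.restrict Ω) := by
  simpa using (hp.locallyIntegrable hq).integrable_smul_right_of_hasCompactSupport hψ hc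

theorem continuous_fderiv_test {ψ : E3 → ℝ} (h : ContDiff ℝ ∞ ψ) (e : E3) :
    Continuous (fun x => fderiv ℝ ψ x e) :=
  (h.continuous_fderiv (by simp)).clm_apply continuous_const

theorem hasCompactSupport_fderiv_test {ψ : E3 → ℝ} (h : HasCompactSupport ψ) (e : E3) :
    HasCompactSupport (fun x => fderiv ℝ ψ x e) :=
  h.fderiv_apply (𝕜 := ℝ) e

theorem memLp_coord {Ω : Set E3} {q : ℝ≥0∞} {g : E3 → E3}
    (hg : MemLp g q (volume.restrict Ω)) (i : Fin 3) :
    MemLp (fun x => g x i) q (volume.restrict Ω) :=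
  (EuclideanSpace.proj (𝕜 := ℝ) i).comp_memLp' hg

theorem HasSobolevGradient.add {Ω : Set E3} {q : ℝ≥0∞} (hq : 1 ≤ q) {p r : E3 → ℝ}
    {g h : E3 → E3} (hp : HasSobolevGradient Ω q p g) (hr : HasSobolevGradient Ω q r h) :
    HasSobolevGradient Ω q (p + r) (g + h) := by
  refine ⟨hp.memLp.add hr.memLp, hp.memLp_grad.add hr.memLp_grad, ?_⟩
  intro ψ h1 h2 h3 i
  have hc := continuous_fderiv_test h1 (EuclideanSpace.single i 1)
  have hs := hasCompactSupport_fderiv_test h2 (EuclideanSpace.single i 1)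
  simp only [Pi.add_apply, PiLp.add_apply, add_mul]
  rw [integral_add (integrable_mul_test hq hp.memLp hc hs) (integrable_mul_test hq hr.memLp hc hs),
    integral_add (integrable_mul_test hq (memLp_coord hp.memLp_grad i) h1.continuous h2)
      (integrable_mul_test hq (memLp_coord hr.memLp_grad i) h1.continuous h2),
    hp.isWeakGradient ψ h1 h2 h3 i, hr.isWeakGradient ψ h1 h2 h3 i]
  ring

theorem HasSobolevGradient.smul {Ω : Set E3} {q : ℝ≥0∞} (c : ℝ) {p : E3 → ℝ}
    {g : E3 → E3} (hp : HasSobolevGradient Ω q p g) :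
    HasSobolevGradient Ω q (c • p) (c • g) := by
  refine ⟨hp.memLp.const_smul c, hp.memLp_grad.const_smul c, ?_⟩
  intro ψ h1 h2 h3 i
  simp only [Pi.smul_apply, PiLp.smul_apply, smul_eq_mul, mul_assoc]
  rw [integral_const_mul, integral_const_mul, hp.isWeakGradient ψ h1 h2 h3 i]
  ring

theorem HasSobolevGradient.congr {Ω : Set E3} {q : ℝ≥0∞} {p : E3 → ℝ} {g h : E3 → E3}
    (hp : HasSobolevGradient Ω q p g) (hgh : g =ᵐ[volume.restrict Ω] h) :
    HasSobolevGradient Ω q p h :=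
  ⟨hp.memLp, hp.memLp_grad.ae_eq hgh, hp.isWeakGradient.congr hgh⟩

theorem hasSobolevGradient_zero {Ω : Set E3} {q : ℝ≥0∞} : HasSobolevGradient Ω q 0 0 := by
  refine ⟨MemLp.zero, MemLp.zero, ?_⟩
  intro ψ h1 h2 h3 i
  simp

/-- The space `G_q(Ω) = {∇p : p ∈ W¹_q(Ω)}` of gradient fields. -/
noncomputable def gradientFields (Ω : Set E3) (q : ℝ≥0∞) [Fact (1 ≤ q)] : Submodule ℝ (LqField Ω q) where
  carrier := {u | ∃ p : E3 → ℝ, HasSobolevGradient Ω q p u}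
  zero_mem' := ⟨0, hasSobolevGradient_zero.congr (Lp.coeFn_zero _ _ _).symm⟩
  add_mem' := by
    rintro u v ⟨p, hp⟩ ⟨r, hr⟩
    exact ⟨p + r, (hp.add Fact.out hr).congr (Lp.coeFn_add u v).symm⟩
  smul_mem' := by
    rintro c u ⟨p, hp⟩
    exact ⟨c • p, (hp.smul c).congr (Lp.coeFn_smul c u).symm⟩

theorem integrable_inner_of_conj {Ω : Set E3} {q q' : ℝ≥0∞} (h : q.HolderConjugate q')
    {v g : E3 → E3} (hv : MemLp v q (volume.restrict Ω)) (hg : MemLp g q' (volume.restrict Ω)) :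
    Integrable (fun x => inner ℝ (v x) (g x)) (volume.restrict Ω) := by
  rw [← memLp_one_iff_integrable]
  refine MemLp.of_bilin (fun a b : E3 => inner ℝ a b) 1 hv hg
    (hv.aestronglyMeasurable.inner hg.aestronglyMeasurable) (Filter.Eventually.of_forall ?_)
  intro x
  rw [one_mul]
  exact nnnorm_inner_le_nnnorm _ _

/-- The space `L_{q,σ}(Ω)` of solenoidal fields in `L_q(Ω)` with zero normal component on `∂Ω`. -/
noncomputable def solenoidalFields (Ω : Set E3) (q : ℝ≥0∞) [Fact (1 ≤ q)] : Submodule ℝ (LqField Ω q) where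
  carrier := {v | IsSolenoidal Ω q v}
  zero_mem' := by
    intro q' _ φ g _
    refine integral_eq_zero_of_ae ?_
    filter_upwards [Lp.coeFn_zero E3 q (volume.restrict Ω)] with x hx
    exact (congrArg (fun z => inner ℝ z (g x)) hx).trans (inner_zero_left _)
  add_mem' := by
    intro u v hu hv q' hq' φ g hg
    have e : ∫ x in Ω, inner ℝ ((u + v : LqField Ω q) x) (g x) =
        ∫ x in Ω, (inner ℝ (u x) (g x) + inner ℝ (v x) (g x)) := by
      refine integral_congr_ae ?_
      filter_upwards [Lp.coeFn_add u v] with x hx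
      rw [hx, Pi.add_apply, inner_add_left]
    rw [e, integral_add (integrable_inner_of_conj hq' (Lp.memLp u) hg.memLp_grad)
      (integrable_inner_of_conj hq' (Lp.memLp v) hg.memLp_grad), hu q' hq' φ g hg,
      hv q' hq' φ g hg, add_zero]
  smul_mem' := by
    intro c u hu q' hq' φ g hg
    have e : ∫ x in Ω, inner ℝ ((c • u : LqField Ω q) x) (g x) =
        ∫ x in Ω, c * inner ℝ (u x) (g x) := by
      refine integral_congr_ae ?_
      filter_upwards [Lp.coeFn_smul c u] with x hx
      rw [hx, Pi.smul_apply, real_inner_smul_left]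
    rw [e, integral_const_mul, hu q' hq' φ g hg, mul_zero]

open Classical in
/-- The Helmholtz projection `ℙ` of `L_q(Ω)` onto `L_{q,σ}(Ω)`: the projection along `G_q(Ω)` in
the Helmholtz decomposition `L_q(Ω) = L_{q,σ}(Ω) ⊕ G_q(Ω)`. (The decomposition holds for every
bounded `C³` domain and `1 < q < ∞`; as a total function, `ℙ` is `0` where it fails.) -/
noncomputable def helmholtz (Ω : Set E3) (q : ℝ≥0∞) [Fact (1 ≤ q)] :
    LqField Ω q →ₗ[ℝ] solenoidalFields Ω q :=
  if h : IsCompl (solenoidalFields Ω q) (gradientFields Ω q) then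
    Submodule.projectionOnto (solenoidalFields Ω q) (gradientFields Ω q) h
  else 0

theorem continuous_cross_left (a : E3) : Continuous (fun x => cross x a) := by
  have h : Continuous (fun x : E3 => crossProduct (WithLp.ofLp x) (WithLp.ofLp a)) := by
    refine continuous_pi fun i => ?_
    fin_cases i <;> simp [cross_apply] <;> fun_prop
  exact (PiLp.continuous_toLp 2 _).comp h

theorem memLp_cross {Ω : Set E3} (hΩ : IsBoundedC3Domain Ω) (q : ℝ≥0∞) (a : E3) :
    MemLp (fun x => cross x a) q (volume.restrict Ω) := by
  have : IsFiniteMeasure (volume.restrict Ω) :=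
    ⟨by simpa using hΩ.isBounded.measure_lt_top⟩
  have hK : IsCompact (closure Ω) := hΩ.isBounded.isCompact_closure
  obtain ⟨M, hM⟩ := hK.exists_bound_of_continuousOn (continuous_cross_left a).continuousOn
  refine MemLp.of_bound (continuous_cross_left a).aestronglyMeasurable M ?_
  filter_upwards [ae_restrict_mem hΩ.isOpen.measurableSet] with x hx
  exact hM x (subset_closure hx)

/-- The vector field `x ↦ x × a` as an element of `L_q(Ω)`. -/
noncomputable def crossField {Ω : Set E3} (hΩ : IsBoundedC3Domain Ω) (q : ℝ≥0∞) (a : E3) :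
    LqField Ω q :=
  (memLp_cross hΩ q a).toLp (fun x => cross x a)

/-- The angular momentum `∫_Ω x × v dx` of the fluid. -/
noncomputable def fluidMomentum (Ω : Set E3) (v : E3 → E3) : E3 :=
  ∫ x in Ω, cross x (v x)

/-- The space `X₀ = L_{q,σ}(Ω) × ℝ³`. -/
noncomputable abbrev X0 (Ω : Set E3) (q : ℝ≥0∞) [Fact (1 ≤ q)] := solenoidalFields Ω q × E3

/-- The operator
`E (v, a) = (v + ℙ (x × 𝕀⁻¹ ∫_Ω x × v dx) - ℙ (x × a), 𝕀 a)` on `X₀`. -/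
noncomputable def opE {Ω : Set E3} (hΩ : IsBoundedC3Domain Ω) (I : Matrix (Fin 3) (Fin 3) ℝ)
    (q : ℝ≥0∞) [Fact (1 ≤ q)] (u : X0 Ω q) : X0 Ω q :=
  (u.1 + helmholtz Ω q (crossField hΩ q (act I⁻¹ (fluidMomentum Ω (u.1 : LqField Ω q))))
      - helmholtz Ω q (crossField hΩ q u.2),
    act I u.2)

/-! Write `w a = ℙ (x × a)` and `M v = ∫_Ω x × v`. Then `E` is block triangular with diagonal blocks
`1 + w 𝕀⁻¹ M` and `𝕀`. The first block is a perturbation of the identity that factors through `ℝ³`,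
so by the Woodbury formula its inverse is `1 + C` with `C = -w D⁻¹ M`, provided that the map `D = 𝕀
+ M w` of `ℝ³` is invertible. Finite rank and compactness of `C` are then immediate
(`exists_blockTriangular_equiv`, `isUnit_one_add_woodbury`).

Invertibility of `D` is decided in `L_2`. There `ℙ` is orthogonal and `M = -w*`, whence `(D a|a) =
(𝕀 a|a) - |ℙ (x × a)|²`. The fluid part of `(𝕀 a|a)` is `|x × a|²` in `L_2(Ω)`, which dominates the
projected term, and the solid part is strictly positive for `a ≠ 0` (`norm_projCross_sq_lt`).
Moreover `C₂ = w D⁻¹ w*` is symmetric and nonnegative, so `I + C₂ ≥ I` and `c = 1` works.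

The passage to general `q` rests on `helmholtz_ae_eq_orthogonalProjection`: the function `ℙ (x × a)`
does not depend on the exponent, hence neither does `D`. Only the Helmholtz decomposition at the
exponent `q` itself is needed for this; where it fails, `ℙ = 0` by definition and `C = 0` suffices.
-/

/-! ### Lebesgue spaces over a finite measure -/

section LpInclusion

variable {α F : Type*} [MeasurableSpace α] [NormedAddCommGroup F] [NormedSpace ℝ F]
  {μ : Measure α} [IsFiniteMeasure μ] {p r : ℝ≥0∞} [Fact (1 ≤ p)] [Fact (1 ≤ r)]

theorem exists_lpInclusion (hpr : p ≤ r) (hr : r ≠ ⊤) :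
    ∃ ι : Lp F r μ →L[ℝ] Lp F p μ, ∀ f, ι f =ᵐ[μ] f := by
  let T : Lp F r μ →ₗ[ℝ] Lp F p μ :=
    { toFun := fun f => ((Lp.memLp f).mono_exponent hpr).toLp f
      map_add' := fun f g => by
        rw [← MemLp.toLp_add]
        exact MemLp.toLp_congr _ _ (Lp.coeFn_add f g)
      map_smul' := fun c f => by
        rw [RingHom.id_apply, ← MemLp.toLp_const_smul]
        exact MemLp.toLp_congr _ _ (Lp.coeFn_smul c f) }
  have hp0 : 0 < p.toReal :=
    ENNReal.toReal_pos (zero_lt_one.trans_le (Fact.out : 1 ≤ p)).ne' (ne_top_of_le_ne_top hr hpr)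
  have hexp : 0 ≤ 1 / p.toReal - 1 / r.toReal :=
    sub_nonneg.2 (one_div_le_one_div_of_le hp0 (ENNReal.toReal_mono hr hpr))
  refine ⟨T.mkContinuous (μ Set.univ ^ (1 / p.toReal - 1 / r.toReal)).toReal fun f => ?_,
    fun f => MemLp.coeFn_toLp ((Lp.memLp f).mono_exponent hpr)⟩
  have h := eLpNorm_le_eLpNorm_mul_rpow_measure_univ hpr (Lp.memLp f).aestronglyMeasurable
  have hfin : μ Set.univ ^ (1 / p.toReal - 1 / r.toReal) ≠ ⊤ :=
    ENNReal.rpow_ne_top_of_nonneg hexp (measure_ne_top μ _)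
  calc ‖T f‖ = (eLpNorm f p μ).toReal := Lp.norm_toLp _ ((Lp.memLp f).mono_exponent hpr)
    _ ≤ (eLpNorm f r μ * μ Set.univ ^ (1 / p.toReal - 1 / r.toReal)).toReal :=
        ENNReal.toReal_mono (ENNReal.mul_ne_top (Lp.memLp f).eLpNorm_ne_top hfin) h
    _ = _ := by rw [ENNReal.toReal_mul, mul_comm, Lp.norm_def]

end LpInclusion

theorem exists_holderConjugate {q : ℝ≥0∞} (hq : 1 ≤ q) :
    ∃ q' : ℝ≥0∞, 1 ≤ q' ∧ q.HolderConjugate q' := by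
  have h := ENNReal.HolderConjugate.conjExponent hq
  exact ⟨_, ENNReal.HolderConjugate.one_le q.conjExponent q, h⟩

theorem holderConjugate_antitone {q r q' r' : ℝ≥0∞} (h : q.HolderConjugate q')
    (h' : r.HolderConjugate r') (hqr : q ≤ r) : r' ≤ q' := by
  rw [← ENNReal.inv_le_inv, ← ENNReal.HolderConjugate.one_sub_inv q q',
    ← ENNReal.HolderConjugate.one_sub_inv r r']
  exact tsub_le_tsub_left (ENNReal.inv_le_inv.2 hqr) 1

/-! ### Monotonicity in the exponent -/

theorem IsBoundedC3Domain.isFiniteMeasure_restrict {Ω : Set E3} (hΩ : IsBoundedC3Domain Ω) :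
    IsFiniteMeasure (volume.restrict Ω) :=
  ⟨by simpa using hΩ.isBounded.measure_lt_top⟩

theorem HasSobolevGradient.mono_exponent {Ω : Set E3} [IsFiniteMeasure (volume.restrict Ω)]
    {q r : ℝ≥0∞} {p : E3 → ℝ} {g : E3 → E3} (h : HasSobolevGradient Ω r p g) (hqr : q ≤ r) :
    HasSobolevGradient Ω q p g :=
  ⟨h.memLp.mono_exponent hqr, h.memLp_grad.mono_exponent hqr, h.isWeakGradient⟩

/-- Lowering the exponent raises the dual one, so every test function for `q` is already a test
function for `r`. -/
theorem IsSolenoidal.mono_exponent {Ω : Set E3} [IsFiniteMeasure (volume.restrict Ω)]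
    {q r : ℝ≥0∞} (hr : 1 ≤ r) {v : E3 → E3} (h : IsSolenoidal Ω r v) (hqr : q ≤ r) :
    IsSolenoidal Ω q v := by
  intro q' hq' φ g hg
  obtain ⟨r', -, hr'⟩ := exists_holderConjugate hr
  exact h r' hr' φ g (hg.mono_exponent (holderConjugate_antitone hq' hr' hqr))

theorem IsSolenoidal.congr {Ω : Set E3} {q : ℝ≥0∞} {v w : E3 → E3} (h : IsSolenoidal Ω q v)
    (hvw : v =ᵐ[volume.restrict Ω] w) : IsSolenoidal Ω q w := by
  intro q' hq' φ g hg
  rw [← h q' hq' φ g hg]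
  refine integral_congr_ae ?_
  filter_upwards [hvw] with x hx
  rw [hx]

/-! ### Duality between `L_q` and `L_{q'}` -/

theorem exists_innerFunctional {Ω : Set E3} {q q' : ℝ≥0∞} [Fact (1 ≤ q)]
    (h : q.HolderConjugate q') {g : E3 → E3} (hg : MemLp g q' (volume.restrict Ω)) :
    ∃ l : LqField Ω q →L[ℝ] ℝ, ∀ v, l v = ∫ x in Ω, inner ℝ (v x) (g x) := by
  have := h
  have : Fact (1 ≤ q') := ⟨ENNReal.HolderConjugate.one_le q' q⟩
  refine ⟨((innerSL ℝ : E3 →L[ℝ] E3 →L[ℝ] ℝ).lpPairing (volume.restrict Ω) q q').flip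
    (hg.toLp g), fun v => ?_⟩
  rw [ContinuousLinearMap.flip_apply, ContinuousLinearMap.lpPairing_eq_integral]
  refine integral_congr_ae ?_
  filter_upwards [hg.coeFn_toLp] with x hx
  rw [hx, innerSL_apply_apply]

theorem exists_mulFunctional {Ω : Set E3} {q : ℝ≥0∞} [Fact (1 ≤ q)] {θ : E3 → ℝ}
    (hθ : Continuous θ) (hc : HasCompactSupport θ) :
    ∃ l : Lp ℝ q (volume.restrict Ω) →L[ℝ] ℝ, ∀ p, l p = ∫ x in Ω, p x * θ x := by
  obtain ⟨q', hq', h⟩ := exists_holderConjugate (Fact.out : 1 ≤ q)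
  have := h
  have : Fact (1 ≤ q') := ⟨hq'⟩
  have hm : MemLp θ q' (volume.restrict Ω) := hθ.memLp_of_hasCompactSupport hc
  refine ⟨((ContinuousLinearMap.mul ℝ ℝ).lpPairing (volume.restrict Ω) q q').flip
    (hm.toLp θ), fun v => ?_⟩
  rw [ContinuousLinearMap.flip_apply, ContinuousLinearMap.lpPairing_eq_integral]
  refine integral_congr_ae ?_
  filter_upwards [hm.coeFn_toLp] with x hx
  rw [hx, ContinuousLinearMap.mul_apply']

theorem exists_coordMulFunctional {Ω : Set E3} {q : ℝ≥0∞} [Fact (1 ≤ q)] {θ : E3 → ℝ}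
    (hθ : Continuous θ) (hc : HasCompactSupport θ) (i : Fin 3) :
    ∃ l : LqField Ω q →L[ℝ] ℝ, ∀ g, l g = ∫ x in Ω, g x i * θ x := by
  obtain ⟨l, hl⟩ := exists_mulFunctional (Ω := Ω) (q := q) hθ hc
  refine ⟨l.comp ((EuclideanSpace.proj (𝕜 := ℝ) i).compLpL q (volume.restrict Ω)), fun g => ?_⟩
  rw [ContinuousLinearMap.comp_apply, hl]
  refine integral_congr_ae ?_
  filter_upwards [(EuclideanSpace.proj (𝕜 := ℝ) i).coeFn_compLpL g] with x hx
  rw [hx]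
  rfl

/-! ### Closedness of the two factors of the Helmholtz decomposition -/

theorem isClosed_solenoidalFields (Ω : Set E3) (q : ℝ≥0∞) [Fact (1 ≤ q)] :
    IsClosed (solenoidalFields Ω q : Set (LqField Ω q)) := by
  have e : (solenoidalFields Ω q : Set (LqField Ω q)) =
      ⋂ (q' : ℝ≥0∞) (_ : q.HolderConjugate q') (φ : E3 → ℝ) (g : E3 → E3)
        (_ : HasSobolevGradient Ω q' φ g),
        {v : LqField Ω q | ∫ x in Ω, inner ℝ (v x) (g x) = 0} := by
    ext v
    simp only [Set.mem_iInter, Set.mem_ofPred_eq]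
    exact Iff.rfl
  rw [e]
  refine isClosed_iInter fun q' => isClosed_iInter fun hq' => isClosed_iInter fun φ =>
    isClosed_iInter fun g => isClosed_iInter fun hg => ?_
  obtain ⟨l, hl⟩ := exists_innerFunctional (q := q) hq' hg.memLp_grad
  simp_rw [← hl]
  exact isClosed_eq l.continuous continuous_const

instance completeSpace_solenoidalFields (Ω : Set E3) (q : ℝ≥0∞) [Fact (1 ≤ q)] :
    CompleteSpace (solenoidalFields Ω q) :=
  (isClosed_solenoidalFields Ω q).completeSpace_coe

/-- `W¹_q(Ω)` is realised as the graph of the weak gradient. Each test function and coordinate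
imposes one continuous linear equation, so the graph is closed and therefore a Banach space, as the
open mapping theorem requires. -/
theorem exists_sobolevGraph (Ω : Set E3) (q : ℝ≥0∞) [Fact (1 ≤ q)] :
    ∃ S : Submodule ℝ (Lp ℝ q (volume.restrict Ω) × LqField Ω q),
      IsClosed (S : Set (Lp ℝ q (volume.restrict Ω) × LqField Ω q)) ∧
      ∀ z, z ∈ S ↔ IsWeakGradient Ω z.1 z.2 := by
  let ι := {ψ : E3 → ℝ // ContDiff ℝ ∞ ψ ∧ HasCompactSupport ψ ∧ tsupport ψ ⊆ Ω} × Fin 3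
  choose l hl using fun t : ι => exists_mulFunctional (Ω := Ω) (q := q)
    (continuous_fderiv_test t.1.2.1 (EuclideanSpace.single t.2 1))
    (hasCompactSupport_fderiv_test t.1.2.2.1 (EuclideanSpace.single t.2 1))
  choose m hm using fun t : ι => exists_coordMulFunctional (Ω := Ω) (q := q)
    t.1.2.1.continuous t.1.2.2.1 t.2
  refine ⟨⨅ t : ι, ((l t).coprod (m t)).ker, ?_, fun z => ?_⟩
  · rw [Submodule.coe_iInf]
    exact isClosed_iInter fun t => ((l t).coprod (m t)).isClosed_ker
  · simp only [Submodule.mem_iInf, LinearMap.mem_ker, ContinuousLinearMap.coe_coe,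
      ContinuousLinearMap.coprod_apply, hl, hm, add_eq_zero_iff_eq_neg]
    exact ⟨fun h ψ h1 h2 h3 i => h (⟨ψ, h1, h2, h3⟩, i),
      fun h t => h t.1.1 t.1.2.1 t.1.2.2.1 t.1.2.2.2 t.2⟩

theorem IsWeakGradient.congr_left {Ω : Set E3} {p r : E3 → ℝ} {g : E3 → E3}
    (hp : IsWeakGradient Ω p g) (hpr : p =ᵐ[volume.restrict Ω] r) : IsWeakGradient Ω r g := by
  intro ψ h1 h2 h3 i
  rw [← hp ψ h1 h2 h3 i]
  refine integral_congr_ae ?_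
  filter_upwards [hpr] with x hx
  rw [hx]

/-- If the Helmholtz decomposition holds in `L_q(Ω)`, then the space of gradient fields is closed:
by the open mapping theorem, `W¹_q(Ω) × L_{q,σ}(Ω) → L_q(Ω)`, `(p, v) ↦ ∇p + v`, is a quotient
map. -/
theorem isClosed_gradientFields {Ω : Set E3} {q : ℝ≥0∞} [Fact (1 ≤ q)]
    (hc : IsCompl (solenoidalFields Ω q) (gradientFields Ω q)) :
    IsClosed (gradientFields Ω q : Set (LqField Ω q)) := by
  obtain ⟨S, hS, hmem⟩ := exists_sobolevGraph Ω q
  have : CompleteSpace S := hS.completeSpace_coe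
  let Φ : S × solenoidalFields Ω q →L[ℝ] LqField Ω q :=
    ((ContinuousLinearMap.snd ℝ _ _).comp S.subtypeL).coprod (solenoidalFields Ω q).subtypeL
  have hΦ : ∀ s v, Φ (s, v) = s.1.2 + v.1 := fun s v => rfl
  have hgrad : ∀ s : S, s.1.2 ∈ gradientFields Ω q := fun s =>
    ⟨s.1.1, Lp.memLp _, Lp.memLp _, (hmem _).1 s.2⟩
  have hsurj : Function.Surjective Φ := by
    intro u
    obtain ⟨v, hv, g, ⟨p, hp⟩, rfl⟩ := Submodule.mem_sup.1
      (show u ∈ solenoidalFields Ω q ⊔ gradientFields Ω q by rw [hc.sup_eq_top]; trivial)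
    refine ⟨(⟨(hp.memLp.toLp p, g), (hmem _).2
      (hp.isWeakGradient.congr_left hp.memLp.coeFn_toLp.symm)⟩, ⟨v, hv⟩), ?_⟩
    rw [hΦ, add_comm]
  have hquot := (Φ.isOpenMap hsurj).isQuotientMap Φ.continuous hsurj
  rw [← hquot.isClosed_preimage]
  -- `∇p + v` is a gradient only if `v` is, and then `v = 0` because the two factors meet trivially.
  have e : Φ ⁻¹' (gradientFields Ω q : Set (LqField Ω q)) = {z | z.2 = 0} := by
    ext ⟨s, v⟩
    simp only [Set.mem_preimage, SetLike.mem_coe, Set.mem_ofPred_eq, hΦ]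
    rw [Submodule.add_mem_iff_right _ (hgrad s)]
    refine ⟨fun h => ?_, fun h => by rw [h]; exact Submodule.zero_mem _⟩
    exact Subtype.ext (Submodule.disjoint_def.1 hc.disjoint _ v.2 h)
  rw [e]
  exact isClosed_eq continuous_snd continuous_const

/-! ### The Helmholtz projection on `L_q ∩ L_2` -/

/-- The exponent `2` is its own conjugate, so the weak definition of solenoidality is literally
orthogonality to the gradients. -/
theorem solenoidalFields_two_eq_orthogonal (Ω : Set E3) :
    solenoidalFields Ω 2 = (gradientFields Ω 2)ᗮ := by
  ext v
  rw [Submodule.mem_orthogonal']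
  constructor
  · rintro hv g ⟨p, hp⟩
    rw [L2.inner_def]
    exact hv 2 inferInstance p g hp
  · intro hv q' hq' φ g hg
    obtain rfl := ENNReal.HolderConjugate.unique 2 2 q'
    have h := hv (hg.memLp_grad.toLp g) ⟨φ, hg.congr hg.memLp_grad.coeFn_toLp.symm⟩
    rw [L2.inner_def] at h
    rw [← h]
    refine integral_congr_ae ?_
    filter_upwards [hg.memLp_grad.coeFn_toLp] with x hx
    rw [hx]

theorem helmholtz_eq_of_add {Ω : Set E3} {q : ℝ≥0∞} [Fact (1 ≤ q)]
    (hc : IsCompl (solenoidalFields Ω q) (gradientFields Ω q)) {f v g : LqField Ω q}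
    (hf : f = v + g) (hv : v ∈ solenoidalFields Ω q) (hg : g ∈ gradientFields Ω q) :
    helmholtz Ω q f = ⟨v, hv⟩ := by
  rw [helmholtz, dif_pos hc, hf, map_add, Submodule.projectionOnto_apply_of_mem_left hc hv,
    (Submodule.projectionOnto_apply_eq_zero_iff hc).2 hg, add_zero]

/-- The inclusion `L_q ⊆ L_2` respects both factors, so it carries the Helmholtz decomposition in
`L_q` to an orthogonal decomposition in `L_2`. -/
theorem helmholtz_ae_eq_orthogonalProjection_of_two_le {Ω : Set E3}
    [IsFiniteMeasure (volume.restrict Ω)] {q : ℝ≥0∞} [Fact (1 ≤ q)] (hq : q < ⊤) (h2 : 2 ≤ q)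
    (hc : IsCompl (solenoidalFields Ω q) (gradientFields Ω q)) {f : LqField Ω q}
    {f₂ : LqField Ω 2} (hf : f =ᵐ[volume.restrict Ω] f₂) :
    ((helmholtz Ω q f : LqField Ω q) : E3 → E3) =ᵐ[volume.restrict Ω]
      ((solenoidalFields Ω 2).orthogonalProjectionOnto f₂ : LqField Ω 2) := by
  obtain ⟨ι, hι⟩ := exists_lpInclusion (F := E3) (μ := volume.restrict Ω) h2 hq.ne
  obtain ⟨v, hv, g, hg, rfl⟩ := Submodule.mem_sup.1
    (show f ∈ solenoidalFields Ω q ⊔ gradientFields Ω q by rw [hc.sup_eq_top]; trivial)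
  rw [helmholtz_eq_of_add hc rfl hv hg]
  have hvι : ι v ∈ solenoidalFields Ω 2 :=
    (IsSolenoidal.mono_exponent (q := 2) Fact.out hv h2).congr (hι v).symm
  have hgι : ι g ∈ (solenoidalFields Ω 2)ᗮ := by
    obtain ⟨p, hp⟩ := hg
    rw [solenoidalFields_two_eq_orthogonal]
    exact Submodule.le_orthogonal_orthogonal _
      ⟨p, (hp.mono_exponent h2).congr (hι g).symm⟩
  have e : f₂ = ι v + ι g := by
    rw [← map_add]
    exact Lp.ext (hf.symm.trans (hι _).symm)
  have e' := Submodule.eq_starProjection_of_mem_orthogonal' hvι hgι e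
  rw [Submodule.starProjection_apply] at e'
  rw [e']
  exact (hι v).symm

/-- Now the orthogonal decomposition in `L_2` is carried into `L_q`. The orthogonal complement of
`L_{2,σ}` is a priori only the closure of the gradients; the inclusion still maps it into `G_q`,
because `G_q` is closed. -/
theorem helmholtz_ae_eq_orthogonalProjection_of_le_two {Ω : Set E3}
    [IsFiniteMeasure (volume.restrict Ω)] {q : ℝ≥0∞} [Fact (1 ≤ q)] (h2 : q ≤ 2)
    (hc : IsCompl (solenoidalFields Ω q) (gradientFields Ω q)) {f : LqField Ω q}
    {f₂ : LqField Ω 2} (hf : f =ᵐ[volume.restrict Ω] f₂) :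
    ((helmholtz Ω q f : LqField Ω q) : E3 → E3) =ᵐ[volume.restrict Ω]
      ((solenoidalFields Ω 2).orthogonalProjectionOnto f₂ : LqField Ω 2) := by
  obtain ⟨ι, hι⟩ := exists_lpInclusion (F := E3) (μ := volume.restrict Ω) h2 (by simp)
  obtain ⟨v, hv⟩ : ∃ v, v = (solenoidalFields Ω 2).orthogonalProjectionOnto f₂ := ⟨_, rfl⟩
  rw [← hv]
  have hvι : ι v ∈ solenoidalFields Ω q :=
    (IsSolenoidal.mono_exponent (r := 2) Fact.out v.2 h2).congr (hι v).symm
  have hclos : f₂ - v ∈ (gradientFields Ω 2).topologicalClosure := by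
    rw [← Submodule.orthogonal_orthogonal_eq_closure, ← solenoidalFields_two_eq_orthogonal]
    rw [hv]
    exact Submodule.sub_starProjection_mem_orthogonal f₂
  have hgι : ι (f₂ - v) ∈ gradientFields Ω q := by
    have hle : (gradientFields Ω 2).topologicalClosure ≤
        (gradientFields Ω q).comap (ι : LqField Ω 2 →ₗ[ℝ] LqField Ω q) := by
      refine Submodule.topologicalClosure_minimal _ ?_
        ((isClosed_gradientFields hc).preimage ι.continuous)
      rintro g ⟨p, hp⟩
      exact ⟨p, (hp.mono_exponent h2).congr (hι g).symm⟩
    exact hle hclos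
  have e : f = ι v + ι (f₂ - v) := by
    rw [← map_add, add_sub_cancel]
    exact Lp.ext (hf.trans (hι _).symm)
  rw [helmholtz_eq_of_add hc e hvι hgι]
  exact hι v

/-- On `L_q ∩ L_2`, the Helmholtz projection of `L_q(Ω)` acts as the orthogonal projection of
`L_2(Ω)` onto `L_{2,σ}(Ω)`. -/
theorem helmholtz_ae_eq_orthogonalProjection {Ω : Set E3} [IsFiniteMeasure (volume.restrict Ω)]
    {q : ℝ≥0∞} [Fact (1 ≤ q)] (hq : q < ⊤)
    (hc : IsCompl (solenoidalFields Ω q) (gradientFields Ω q)) {f : LqField Ω q}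
    {f₂ : LqField Ω 2} (hf : f =ᵐ[volume.restrict Ω] f₂) :
    ((helmholtz Ω q f : LqField Ω q) : E3 → E3) =ᵐ[volume.restrict Ω]
      ((solenoidalFields Ω 2).orthogonalProjectionOnto f₂ : LqField Ω 2) := by
  rcases le_total 2 q with h2 | h2
  · exact helmholtz_ae_eq_orthogonalProjection_of_two_le hq h2 hc hf
  · exact helmholtz_ae_eq_orthogonalProjection_of_le_two h2 hc hf

/-! ### The cross product -/

/-- Antisymmetry of the triple product; this is the source of the relation `M = -w*`. -/
theorem inner_cross_left (x v a : E3) : inner ℝ (cross x v) a = -inner ℝ v (cross x a) := by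
  simp [cross, cross_apply, PiLp.inner_apply, Fin.sum_univ_three]
  ring

theorem cross_add_right (x a b : E3) : cross x (a + b) = cross x a + cross x b := by
  ext i
  fin_cases i <;> simp [cross, cross_apply] <;> ring

theorem cross_smul_right (c : ℝ) (x a : E3) : cross x (c • a) = c • cross x a := by
  ext i
  fin_cases i <;> simp [cross, cross_apply]

theorem norm_cross_sq (x a : E3) : ‖cross x a‖ ^ 2 =
    ∑ i : Fin 3, ∑ j : Fin 3, (‖x‖ ^ 2 * (if i = j then 1 else 0) - x i * x j) * (a j * a i) := by
  simp [cross, cross_apply, EuclideanSpace.norm_sq_eq, Fin.sum_univ_three]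
  ring

/-- Reduces the vector-valued momentum integral to three scalar pairings of `v` with the fields `x ×
eᵢ`, which yields its integrability and its continuity in `v`. -/
theorem cross_eq_sum (x v : E3) : cross x v =
    ∑ i : Fin 3, (-inner ℝ v (cross x (EuclideanSpace.single i 1))) •
      (EuclideanSpace.single i 1 : E3) := by
  simp_rw [← inner_cross_left]
  ext k
  fin_cases k <;> simp [Fin.sum_univ_three, EuclideanSpace.inner_single_right]

/-- The map `x ↦ x × a`, as a linear map. -/
noncomputable def crossRight (a : E3) : E3 →ₗ[ℝ] E3 where
  toFun x := cross x a
  map_add' x y := by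
    ext i
    fin_cases i <;> simp [cross, cross_apply]
  map_smul' c x := by
    ext i
    fin_cases i <;> simp [cross, cross_apply]

theorem ker_crossRight_ne_top {a : E3} (ha : a ≠ 0) : (crossRight a).ker ≠ ⊤ := by
  intro h
  have h0 : ∀ x, cross x a = 0 := fun x => LinearMap.mem_ker.1 (h ▸ Submodule.mem_top : x ∈ _)
  apply ha
  have h1 := h0 (EuclideanSpace.single 0 1)
  have h2 := h0 (EuclideanSpace.single 1 1)
  ext i
  fin_cases i
  · have := congrArg (fun z : E3 => z 2) h2
    simpa [cross, cross_apply] using this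
  · have := congrArg (fun z : E3 => z 2) h1
    simpa [cross, cross_apply] using this
  · have := congrArg (fun z : E3 => z 1) h1
    simpa [cross, cross_apply] using this

/-- The linear map `a ↦ (x ↦ x × a)` into `L_q(Ω)`. -/
noncomputable def crossFieldLinear {Ω : Set E3} (hΩ : IsBoundedC3Domain Ω) (q : ℝ≥0∞) :
    E3 →ₗ[ℝ] LqField Ω q where
  toFun a := crossField hΩ q a
  map_add' a b := by
    rw [crossField, crossField, crossField, ← MemLp.toLp_add]
    exact MemLp.toLp_congr _ _ (Filter.Eventually.of_forall fun x => cross_add_right x a b)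
  map_smul' c a := by
    rw [RingHom.id_apply, crossField, crossField, ← MemLp.toLp_const_smul]
    exact MemLp.toLp_congr _ _ (Filter.Eventually.of_forall fun x => cross_smul_right c x a)

theorem crossField_ae {Ω : Set E3} (hΩ : IsBoundedC3Domain Ω) (q : ℝ≥0∞) (a : E3) :
    crossField hΩ q a =ᵐ[volume.restrict Ω] fun x => cross x a :=
  MemLp.coeFn_toLp _

/-! ### The angular momentum of the fluid -/

theorem integrable_inner_cross {Ω : Set E3} (hΩ : IsBoundedC3Domain Ω) {q : ℝ≥0∞} (hq : 1 ≤ q)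
    {v : E3 → E3} (hv : MemLp v q (volume.restrict Ω)) (a : E3) :
    Integrable (fun x => inner ℝ (v x) (cross x a)) (volume.restrict Ω) := by
  obtain ⟨q', -, h⟩ := exists_holderConjugate hq
  exact integrable_inner_of_conj h hv (memLp_cross hΩ q' a)

theorem fluidMomentum_eq_sum {Ω : Set E3} (hΩ : IsBoundedC3Domain Ω) {q : ℝ≥0∞} (hq : 1 ≤ q)
    {v : E3 → E3} (hv : MemLp v q (volume.restrict Ω)) :
    fluidMomentum Ω v = ∑ i : Fin 3,
      (-∫ x in Ω, inner ℝ (v x) (cross x (EuclideanSpace.single i 1))) •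
        (EuclideanSpace.single i 1 : E3) := by
  rw [fluidMomentum, integral_congr_ae (Filter.Eventually.of_forall fun x => cross_eq_sum x (v x)),
    integral_finsetSum _ fun i _ =>
      ((integrable_inner_cross hΩ hq hv (EuclideanSpace.single i 1)).fun_neg).smul_const _]
  refine Finset.sum_congr rfl fun i _ => ?_
  rw [integral_smul_const, integral_neg]

theorem inner_fluidMomentum {Ω : Set E3} (hΩ : IsBoundedC3Domain Ω) {q : ℝ≥0∞} (hq : 1 ≤ q)
    {v : E3 → E3} (hv : MemLp v q (volume.restrict Ω)) (a : E3) :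
    inner ℝ (fluidMomentum Ω v) a = -∫ x in Ω, inner ℝ (v x) (cross x a) := by
  have hint : Integrable (fun x => cross x (v x)) (volume.restrict Ω) := by
    simp_rw [cross_eq_sum _ (v _)]
    exact integrable_finsetSum _ fun i _ =>
      ((integrable_inner_cross hΩ hq hv _).neg).smul_const _
  rw [fluidMomentum, real_inner_comm, ← integral_inner hint, ← integral_neg]
  refine integral_congr_ae (Filter.Eventually.of_forall fun x => ?_)
  change inner ℝ a (cross x (v x)) = _
  rw [real_inner_comm, inner_cross_left]

theorem exists_fluidMomentumL {Ω : Set E3} (hΩ : IsBoundedC3Domain Ω) (q : ℝ≥0∞)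
    [Fact (1 ≤ q)] :
    ∃ M : LqField Ω q →L[ℝ] E3, ∀ v, M v = fluidMomentum Ω v := by
  obtain ⟨q', -, h⟩ := exists_holderConjugate (Fact.out : 1 ≤ q)
  choose l hl using fun a : E3 => exists_innerFunctional (q := q) h (memLp_cross hΩ q' a)
  refine ⟨∑ i : Fin 3, (-l (EuclideanSpace.single i 1)).smulRight
    (EuclideanSpace.single i 1 : E3), fun v => ?_⟩
  rw [fluidMomentum_eq_sum hΩ Fact.out (Lp.memLp v), sum_apply]
  refine Finset.sum_congr rfl fun i _ => ?_
  rw [ContinuousLinearMap.smulRight_apply, neg_apply, hl]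

/-! ### The inertia tensor -/

theorem act_add (M : Matrix (Fin 3) (Fin 3) ℝ) (a b : E3) : act M (a + b) = act M a + act M b := by
  simp [act, Matrix.mulVec_add]

theorem act_smul (M : Matrix (Fin 3) (Fin 3) ℝ) (c : ℝ) (a : E3) :
    act M (c • a) = c • act M a := by
  simp [act, Matrix.mulVec_smul]

theorem act_act (M N : Matrix (Fin 3) (Fin 3) ℝ) (a : E3) : act M (act N a) = act (M * N) a := by
  simp [act]

theorem act_one (a : E3) : act 1 a = a := by
  simp [act]

theorem inner_act (M : Matrix (Fin 3) (Fin 3) ℝ) (a b : E3) :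
    inner ℝ (act M a) b = ∑ i : Fin 3, ∑ j : Fin 3, M i j * (a j * b i) := by
  simp [act, PiLp.inner_apply, Matrix.mulVec, dotProduct, Fin.sum_univ_three]
  ring

theorem integrableOn_mul_continuous {S : Set E3} (hS : Bornology.IsBounded S)
    (hm : MeasurableSet S) {σ k : E3 → ℝ} (hσ : IntegrableOn σ S) (hk : Continuous k) :
    IntegrableOn (fun x => σ x * k x) S := by
  obtain ⟨c, hc⟩ := hS.isCompact_closure.exists_bound_of_continuousOn hk.continuousOn
  refine Integrable.mul_bdd (c := c) hσ hk.aestronglyMeasurable ?_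
  filter_upwards [ae_restrict_mem hm] with x hx
  exact hc x (subset_closure hx)

theorem continuous_inertia_entry (i j : Fin 3) :
    Continuous fun x : E3 => ‖x‖ ^ 2 * (if i = j then (1 : ℝ) else 0) - x i * x j := by
  fun_prop

theorem sum_integral_inertia_entry {S : Set E3} (hS : Bornology.IsBounded S)
    (hm : MeasurableSet S) {σ : E3 → ℝ} (hσ : IntegrableOn σ S) (a : E3) :
    ∑ i : Fin 3, ∑ j : Fin 3,
      (∫ x in S, σ x * (‖x‖ ^ 2 * (if i = j then 1 else 0) - x i * x j)) * (a j * a i) =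
      ∫ x in S, σ x * ‖cross x a‖ ^ 2 := by
  have hi : ∀ i j : Fin 3, Integrable (fun x : E3 =>
      σ x * (‖x‖ ^ 2 * (if i = j then 1 else 0) - x i * x j) * (a j * a i))
      (volume.restrict S) := fun i j =>
    (integrableOn_mul_continuous hS hm hσ (continuous_inertia_entry i j)).mul_const _
  simp_rw [norm_cross_sq, Finset.mul_sum, ← mul_assoc (σ _)]
  rw [integral_finsetSum _ fun i _ => integrable_finsetSum _ fun j _ => hi i j]
  refine Finset.sum_congr rfl fun i _ => ?_
  rw [integral_finsetSum _ fun j _ => hi i j]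
  exact Finset.sum_congr rfl fun j _ => (integral_mul_const _ _).symm

/-- The matrix `|x|² I₃ - x ⊗ x` has quadratic form `|x × a|²`. The fluid term is written as an
`L_2` norm so that it can be compared with its projection. -/
theorem inner_act_inertiaTensor_self {Ω B : Set E3} {ρ : E3 → ℝ} (hΩ : IsBoundedC3Domain Ω)
    (hB : IsSolidBody Ω B ρ) (a : E3) :
    inner ℝ (act (inertiaTensor Ω B ρ) a) a =
      ‖crossField hΩ 2 a‖ ^ 2 + ∫ x in B, ρ x * ‖cross x a‖ ^ 2 := by
  have := hΩ.isFiniteMeasure_restrict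
  have h1 : IntegrableOn (fun _ : E3 => (1 : ℝ)) Ω := integrable_const 1
  rw [inner_act, ← sum_integral_inertia_entry hB.isBounded hB.measurableSet hB.density_integrable,
    ← real_inner_self_eq_norm_sq, L2.inner_def]
  have e : ∫ x in Ω, inner ℝ (crossField hΩ 2 a x) (crossField hΩ 2 a x) =
      ∫ x in Ω, 1 * ‖cross x a‖ ^ 2 := by
    refine integral_congr_ae ?_
    filter_upwards [crossField_ae hΩ 2 a] with x hx
    rw [hx, real_inner_self_eq_norm_sq, one_mul]
  rw [e, ← sum_integral_inertia_entry hΩ.isBounded hΩ.isOpen.measurableSet h1]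
  simp_rw [← Finset.sum_add_distrib, ← add_mul, one_mul]
  rfl

theorem inner_act_inertiaTensor_comm (Ω B : Set E3) (ρ : E3 → ℝ) (a b : E3) :
    inner ℝ (act (inertiaTensor Ω B ρ) a) b = inner ℝ (act (inertiaTensor Ω B ρ) b) a := by
  have h : ∀ i j, inertiaTensor Ω B ρ i j = inertiaTensor Ω B ρ j i := by
    intro i j
    simp only [inertiaTensor, Matrix.of_apply, eq_comm (a := i), mul_comm (_ : ℝ) ((_ : E3) i)]
  rw [inner_act, inner_act, Finset.sum_comm]
  refine Finset.sum_congr rfl fun i _ => Finset.sum_congr rfl fun j _ => ?_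
  rw [h j i, mul_comm (a i)]

/-- For `a ≠ 0` the field `x × a` vanishes only on a proper subspace, a null set, while `B` has
positive volume. -/
theorem integral_density_mul_norm_cross_sq_pos {Ω B : Set E3} {ρ : E3 → ℝ}
    (hB : IsSolidBody Ω B ρ) {a : E3} (ha : a ≠ 0) :
    0 < ∫ x in B, ρ x * ‖cross x a‖ ^ 2 := by
  rw [setIntegral_pos_iff_support_of_nonneg_ae]
  · have hnull : volume ((crossRight a).ker : Set E3) = 0 :=
      Measure.addHaar_submodule volume _ (ker_crossRight_ne_top ha)
    have hsub : B \ ((crossRight a).ker : Set E3) ⊆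
        Function.support (fun x => ρ x * ‖cross x a‖ ^ 2) ∩ B := by
      rintro x ⟨hx, hx'⟩
      exact ⟨mul_ne_zero (hB.density_pos x hx).ne' (pow_ne_zero 2 (norm_ne_zero_iff.2 hx')), hx⟩
    refine lt_of_lt_of_le ?_ (measure_mono hsub)
    rw [measure_sdiff_null hnull]
    exact hB.volume_pos
  · filter_upwards [ae_restrict_mem hB.measurableSet] with x hx
    exact mul_nonneg (hB.density_pos x hx).le (sq_nonneg _)
  · exact integrableOn_mul_continuous hB.isBounded hB.measurableSet hB.density_integrable
      ((continuous_cross_left a).norm.pow 2)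

theorem isUnit_inertiaTensor {Ω B : Set E3} {ρ : E3 → ℝ} (hΩ : IsBoundedC3Domain Ω)
    (hB : IsSolidBody Ω B ρ) : IsUnit (inertiaTensor Ω B ρ) := by
  rw [← Matrix.mulVec_injective_iff_isUnit]
  rw [← Matrix.coe_mulVecLin, ← LinearMap.ker_eq_bot, LinearMap.ker_eq_bot']
  intro m hm
  by_contra hne
  have ha : WithLp.toLp 2 m ≠ (0 : E3) := by simpa using hne
  have h := inner_act_inertiaTensor_self hΩ hB (WithLp.toLp 2 m)
  have h0 : act (inertiaTensor Ω B ρ) (WithLp.toLp 2 m) = 0 := by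
    rw [Matrix.mulVecLin_apply] at hm
    simp [act, hm]
  rw [h0, inner_zero_left] at h
  have := integral_density_mul_norm_cross_sq_pos hB ha
  have := sq_nonneg ‖crossField hΩ 2 (WithLp.toLp 2 m)‖
  linarith

/-! ### Finite-rank perturbation of the identity -/

section Woodbury

variable {X V : Type*} [NormedAddCommGroup X] [NormedSpace ℝ X] [NormedAddCommGroup V]
  [NormedSpace ℝ V] (w : V →L[ℝ] X) (M : X →L[ℝ] V) (J D : V ≃L[ℝ] V)

/-- The operator `-w D⁻¹ M`. If `D = J + M w`, then `1 - w D⁻¹ M` is the inverse of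
`1 + w J⁻¹ M` (the Sherman–Morrison–Woodbury formula). -/
noncomputable def woodbury : X →L[ℝ] X :=
  -(w.comp ((D.symm : V →L[ℝ] V).comp M))

theorem woodbury_apply (v : X) : woodbury w M D v = -w (D.symm (M v)) := rfl

variable {w M J D}

/-- With `b = D⁻¹ M v`, the relation `M v = J b + M w b` gives `J⁻¹ M (v - w b) = b`, so the two
corrections cancel. -/
theorem one_add_mul_one_add_woodbury (h : ∀ a, D a = J a + M (w a)) :
    (1 + w.comp ((J.symm : V →L[ℝ] V).comp M)) * (1 + woodbury w M D) = 1 := by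
  ext v
  have h1 := h (D.symm (M v))
  have h2 := congrArg J.symm h1
  rw [D.apply_symm_apply, map_add, J.symm_apply_apply] at h2
  change v + -w (D.symm (M v)) + w (J.symm (M (v + -w (D.symm (M v))))) = v
  rw [map_add, map_add, h2, map_neg, map_neg, map_add, map_add, map_neg]
  abel

/-- With `b = J⁻¹ M v`, the relation reads `D b = M (v + w b)`, so applying `-w D⁻¹ M` to `v + w b`
gives `-w b`. -/
theorem one_add_woodbury_mul_one_add (h : ∀ a, D a = J a + M (w a)) :
    (1 + woodbury w M D) * (1 + w.comp ((J.symm : V →L[ℝ] V).comp M)) = 1 := by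
  ext v
  have h1 := h (J.symm (M v))
  have h2 := congrArg D.symm h1
  rw [D.symm_apply_apply, J.apply_symm_apply] at h2
  change v + w (J.symm (M v)) + -w (D.symm (M (v + w (J.symm (M v))))) = v
  rw [map_add M, ← h2]
  abel

theorem isUnit_one_add_woodbury (h : ∀ a, D a = J a + M (w a)) :
    IsUnit (1 + woodbury w M D) :=
  ⟨⟨_, _, one_add_woodbury_mul_one_add h, one_add_mul_one_add_woodbury h⟩, rfl⟩

theorem isCompactOperator_woodbury [FiniteDimensional ℝ V] :
    IsCompactOperator (woodbury w M D) := by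
  have := FiniteDimensional.proper ℝ V
  exact ((isCompactOperator_of_locallyCompactSpace_dom
    ((D.symm : V →L[ℝ] V).comp M)).clm_comp w).neg

theorem finiteDimensional_range_woodbury [FiniteDimensional ℝ V] :
    FiniteDimensional ℝ (LinearMap.range (woodbury w M D : X →ₗ[ℝ] X)) := by
  refine Submodule.finiteDimensional_of_le (S₂ := LinearMap.range (w : V →ₗ[ℝ] X)) ?_
  rintro _ ⟨v, rfl⟩
  exact ⟨-(D.symm (M v)), map_neg w _⟩

theorem exists_blockTriangular_equiv (h : ∀ a, D a = J a + M (w a)) :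
    ∃ e : (X × V) ≃L[ℝ] (X × V),
      (∀ u, e u = (u.1 + w (J.symm (M u.1)) - w u.2, J u.2)) ∧
      ∀ f b, e.symm (f, b) =
        ((1 + woodbury w M D) f + (1 + woodbury w M D) (w (J.symm b)), J.symm b) := by
  let A := 1 + w.comp ((J.symm : V →L[ℝ] V).comp M)
  have hl : ∀ v, (1 + woodbury w M D) (A v) = v := fun v =>
    congrArg (fun T : X →L[ℝ] X => T v) (one_add_woodbury_mul_one_add h)
  have hr : ∀ v, A ((1 + woodbury w M D) v) = v := fun v =>
    congrArg (fun T : X →L[ℝ] X => T v) (one_add_mul_one_add_woodbury h)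
  let F : (X × V) →L[ℝ] (X × V) :=
    (A.comp (ContinuousLinearMap.fst ℝ X V) - w.comp (ContinuousLinearMap.snd ℝ X V)).prod
      ((J : V →L[ℝ] V).comp (ContinuousLinearMap.snd ℝ X V))
  let G : (X × V) →L[ℝ] (X × V) :=
    ((1 + woodbury w M D).comp (ContinuousLinearMap.fst ℝ X V) +
      ((1 + woodbury w M D).comp (w.comp (J.symm : V →L[ℝ] V))).comp
        (ContinuousLinearMap.snd ℝ X V)).prod
      ((J.symm : V →L[ℝ] V).comp (ContinuousLinearMap.snd ℝ X V))
  have hF : ∀ u, F u = (A u.1 - w u.2, J u.2) := fun u => rfl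
  have hG : ∀ u, G u = ((1 + woodbury w M D) u.1 + (1 + woodbury w M D) (w (J.symm u.2)),
    J.symm u.2) := fun u => rfl
  refine ⟨ContinuousLinearEquiv.equivOfInverse F G (fun u => ?_) (fun u => ?_),
    fun u => rfl, fun f b => rfl⟩
  · rw [hF, hG, J.symm_apply_apply, map_sub, hl, sub_add_cancel]
  · rw [hG, hF, J.apply_symm_apply, map_add, hr, hr, add_sub_cancel_right]

end Woodbury

/-! ### Symmetry and positivity of the perturbation in a Hilbert space -/

section Hilbert

variable {H V : Type*} [NormedAddCommGroup H] [InnerProductSpace ℝ H] [NormedAddCommGroup V]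
  [InnerProductSpace ℝ V] {w : V →L[ℝ] H} {N : H →L[ℝ] V} {D : V ≃L[ℝ] V}

theorem exists_equiv_of_pos [FiniteDimensional ℝ V] (T : V →ₗ[ℝ] V)
    (hT : ∀ a, a ≠ 0 → 0 < inner ℝ (T a) a) : ∃ D : V ≃L[ℝ] V, ∀ a, D a = T a := by
  have hinj : Function.Injective T := by
    rw [← LinearMap.ker_eq_bot, LinearMap.ker_eq_bot']
    intro a ha
    by_contra hne
    have := hT a hne
    rw [ha, inner_zero_left] at this
    exact lt_irrefl _ this
  exact ⟨(LinearEquiv.ofInjectiveEndo T hinj).toContinuousLinearEquiv, fun a => rfl⟩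

/-- If `N = -w*` and `J` is symmetric with `w* w < J`, then `J + N w` is symmetric and positive
definite. -/
theorem exists_equiv_eq_add_comp [FiniteDimensional ℝ V]
    (hN : ∀ v a, inner ℝ (N v) a = -inner ℝ v (w a)) (J : V →L[ℝ] V)
    (hJ : ∀ a b, inner ℝ (J a) b = inner ℝ (J b) a)
    (hpos : ∀ a, a ≠ 0 → ‖w a‖ ^ 2 < inner ℝ (J a) a) :
    ∃ D : V ≃L[ℝ] V, (∀ a, D a = J a + N (w a)) ∧
      (∀ a b, inner ℝ (D a) b = inner ℝ (D b) a) ∧ ∀ a, 0 ≤ inner ℝ (D a) a := by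
  have hT : ∀ a b, inner ℝ ((J + N.comp w) a) b = inner ℝ (J a) b - inner ℝ (w a) (w b) := by
    intro a b
    rw [add_apply, ContinuousLinearMap.comp_apply, inner_add_left, hN, sub_eq_add_neg]
  have hTpos : ∀ a, a ≠ 0 → 0 < inner ℝ ((J + N.comp w) a) a := by
    intro a ha
    rw [hT, real_inner_self_eq_norm_sq]
    exact sub_pos.2 (hpos a ha)
  obtain ⟨D, hD⟩ := exists_equiv_of_pos (J + N.comp w : V →L[ℝ] V).toLinearMap hTpos
  have hD' : ∀ a, D a = (J + N.comp w) a := hD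
  refine ⟨D, fun a => hD' a, fun a b => ?_, fun a => ?_⟩
  · rw [hD', hD', hT, hT, hJ, real_inner_comm (w a)]
  · rcases eq_or_ne a 0 with rfl | ha
    · rw [inner_zero_right]
    · rw [hD']
      exact (hTpos a ha).le

/-- Since `w = -N*`, the operator `-w D⁻¹ N` equals `N* D⁻¹ N` and inherits symmetry and
nonnegativity from `D`. -/
theorem inner_woodbury (hN : ∀ v a, inner ℝ (N v) a = -inner ℝ v (w a)) (u v : H) :
    inner ℝ (woodbury w N D u) v = inner ℝ (N v) (D.symm (N u)) := by
  rw [hN, woodbury_apply, inner_neg_left, real_inner_comm]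

theorem inner_one_add_woodbury_comm (hN : ∀ v a, inner ℝ (N v) a = -inner ℝ v (w a))
    (hD : ∀ a b, inner ℝ (D a) b = inner ℝ (D b) a) (u v : H) :
    inner ℝ ((1 + woodbury w N D) u) v = inner ℝ u ((1 + woodbury w N D) v) := by
  have h := hD (D.symm (N u)) (D.symm (N v))
  rw [D.apply_symm_apply, D.apply_symm_apply] at h
  change inner ℝ (u + woodbury w N D u) v = inner ℝ u (v + woodbury w N D v)
  rw [inner_add_left, inner_add_right, inner_woodbury hN,
    real_inner_comm (woodbury w N D v) u, inner_woodbury hN,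
    h]

theorem norm_sq_le_inner_one_add_woodbury (hN : ∀ v a, inner ℝ (N v) a = -inner ℝ v (w a))
    (hD : ∀ a, 0 ≤ inner ℝ (D a) a) (v : H) :
    ‖v‖ ^ 2 ≤ inner ℝ ((1 + woodbury w N D) v) v := by
  have h := hD (D.symm (N v))
  rw [D.apply_symm_apply] at h
  change _ ≤ inner ℝ (v + woodbury w N D v) v
  rw [inner_add_left, inner_woodbury hN, real_inner_self_eq_norm_sq]
  exact le_add_of_nonneg_right h

theorem inner_one_add_zero_comm (u v : H) :
    inner ℝ ((1 + 0 : H →L[ℝ] H) u) v = inner ℝ u ((1 + 0 : H →L[ℝ] H) v) := by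
  rw [add_zero]
  rfl

theorem norm_sq_le_inner_one_add_zero (v : H) : ‖v‖ ^ 2 ≤ inner ℝ ((1 + 0 : H →L[ℝ] H) v) v := by
  rw [add_zero]
  exact (real_inner_self_eq_norm_sq v).ge

end Hilbert

/-- The action of an invertible matrix on `ℝ³`. -/
theorem exists_actEquiv {M : Matrix (Fin 3) (Fin 3) ℝ} (hM : IsUnit M) :
    ∃ J : E3 ≃L[ℝ] E3, (∀ a, J a = act M a) ∧ ∀ a, J.symm a = act M⁻¹ a := by
  have hdet := (Matrix.isUnit_iff_isUnit_det M).1 hM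
  let J : E3 ≃ₗ[ℝ] E3 :=
    { toFun := act M
      invFun := act M⁻¹
      map_add' := act_add M
      map_smul' := act_smul M
      left_inv := fun a => by rw [act_act, Matrix.nonsing_inv_mul M hdet, act_one]
      right_inv := fun a => by rw [act_act, Matrix.mul_nonsing_inv M hdet, act_one] }
  exact ⟨J.toContinuousLinearEquiv, fun a => rfl, fun a => rfl⟩

/-! ### The field `ℙ (x × a)` -/

/-- The linear map `a ↦ ℙ (x × a)` into `L_{q,σ}(Ω)`. -/
noncomputable def helmholtzCross {Ω : Set E3} (hΩ : IsBoundedC3Domain Ω) (q : ℝ≥0∞)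
    [Fact (1 ≤ q)] : E3 →L[ℝ] solenoidalFields Ω q :=
  LinearMap.toContinuousLinearMap (helmholtz Ω q ∘ₗ crossFieldLinear hΩ q)

theorem helmholtzCross_apply {Ω : Set E3} (hΩ : IsBoundedC3Domain Ω) (q : ℝ≥0∞)
    [Fact (1 ≤ q)] (a : E3) :
    helmholtzCross hΩ q a = helmholtz Ω q (crossField hΩ q a) := rfl

/-- The linear map `a ↦ ℙ (x × a)` into `L_{2,σ}(Ω)`, with `ℙ` the orthogonal projection. -/
noncomputable def projCross {Ω : Set E3} (hΩ : IsBoundedC3Domain Ω) :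
    E3 →L[ℝ] solenoidalFields Ω 2 :=
  (solenoidalFields Ω 2).orthogonalProjectionOnto.comp
    (LinearMap.toContinuousLinearMap (crossFieldLinear hΩ 2))

theorem projCross_apply {Ω : Set E3} (hΩ : IsBoundedC3Domain Ω) (a : E3) :
    projCross hΩ a = (solenoidalFields Ω 2).orthogonalProjectionOnto (crossField hΩ 2 a) := rfl

/-- The field `x × a` is bounded on `Ω`, so it lies in `L_q ∩ L_2`, where the two projections agree.
-/
theorem helmholtzCross_ae_eq_projCross {Ω : Set E3} (hΩ : IsBoundedC3Domain Ω) {q : ℝ≥0∞}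
    [Fact (1 ≤ q)] (hq : q < ⊤) (hc : IsCompl (solenoidalFields Ω q) (gradientFields Ω q))
    (a : E3) :
    ((helmholtzCross hΩ q a : LqField Ω q) : E3 → E3) =ᵐ[volume.restrict Ω]
      ((projCross hΩ a : LqField Ω 2) : E3 → E3) := by
  have := hΩ.isFiniteMeasure_restrict
  exact helmholtz_ae_eq_orthogonalProjection hq hc
    ((crossField_ae hΩ q a).trans (crossField_ae hΩ 2 a).symm)

/-- Pairing with a solenoidal `v` does not distinguish `x × a` from its orthogonal projection, so
the momentum is minus the adjoint of `projCross`. -/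
theorem inner_fluidMomentum_solenoidal {Ω : Set E3} (hΩ : IsBoundedC3Domain Ω)
    (v : solenoidalFields Ω 2) (a : E3) :
    inner ℝ (fluidMomentum Ω (v : LqField Ω 2)) a = -inner ℝ v (projCross hΩ a) := by
  rw [inner_fluidMomentum hΩ Fact.out (Lp.memLp (v : LqField Ω 2)), projCross_apply,
    Submodule.inner_orthogonalProjectionOnto_eq_of_mem_left, L2.inner_def]
  congr 1
  refine integral_congr_ae ?_
  filter_upwards [crossField_ae hΩ 2 a] with x hx
  rw [hx]

theorem norm_projCross_le {Ω : Set E3} (hΩ : IsBoundedC3Domain Ω) (a : E3) :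
    ‖projCross hΩ a‖ ≤ ‖crossField hΩ 2 a‖ := by
  rw [projCross_apply]
  exact (solenoidalFields Ω 2).norm_orthogonalProjectionOnto_apply_le (crossField hΩ 2 a)

theorem norm_projCross_sq_lt {Ω B : Set E3} {ρ : E3 → ℝ} (hΩ : IsBoundedC3Domain Ω)
    (hB : IsSolidBody Ω B ρ) {a : E3} (ha : a ≠ 0) :
    ‖projCross hΩ a‖ ^ 2 < inner ℝ (act (inertiaTensor Ω B ρ) a) a := by
  rw [inner_act_inertiaTensor_self hΩ hB]
  exact lt_add_of_le_of_pos (pow_le_pow_left₀ (norm_nonneg _) (norm_projCross_le hΩ a) 2)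
    (integral_density_mul_norm_cross_sq_pos hB ha)

/-! ### The operator `E`, the reduced inertia tensor, and consistency between exponents -/

theorem fluidMomentum_congr {Ω : Set E3} {v w : E3 → E3} (h : v =ᵐ[volume.restrict Ω] w) :
    fluidMomentum Ω v = fluidMomentum Ω w := by
  refine integral_congr_ae ?_
  filter_upwards [h] with x hx
  rw [hx]

theorem exists_solenoidalMomentumL {Ω : Set E3} (hΩ : IsBoundedC3Domain Ω) (q : ℝ≥0∞)
    [Fact (1 ≤ q)] : ∃ M : solenoidalFields Ω q →L[ℝ] E3,
      ∀ v, M v = fluidMomentum Ω (v : LqField Ω q) := by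
  obtain ⟨M, hM⟩ := exists_fluidMomentumL hΩ q
  exact ⟨M.comp (solenoidalFields Ω q).subtypeL, fun v => hM v⟩

theorem exists_opE_equiv {Ω : Set E3} (hΩ : IsBoundedC3Domain Ω)
    {I : Matrix (Fin 3) (Fin 3) ℝ} (q : ℝ≥0∞) [Fact (1 ≤ q)] {J D : E3 ≃L[ℝ] E3}
    (hJ : ∀ a, J a = act I a) (hJs : ∀ a, J.symm a = act I⁻¹ a)
    {M : solenoidalFields Ω q →L[ℝ] E3}
    (hM : ∀ v, M v = fluidMomentum Ω (v : LqField Ω q))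
    (hD : ∀ a, D a = J a + M (helmholtzCross hΩ q a)) :
    ∃ e : X0 Ω q ≃L[ℝ] X0 Ω q,
      (∀ u, e u = opE hΩ I q u) ∧
      ∀ (f : solenoidalFields Ω q) (b : E3), e.symm (f, b) =
        ((1 + woodbury (helmholtzCross hΩ q) M D) f +
          (1 + woodbury (helmholtzCross hΩ q) M D)
            (helmholtz Ω q (crossField hΩ q (act I⁻¹ b))), act I⁻¹ b) := by
  refine (exists_blockTriangular_equiv hD).imp fun e he => ⟨fun u => ?_, fun f b => ?_⟩
  · have h : J.symm (M u.1) = act I⁻¹ (fluidMomentum Ω (u.1 : LqField Ω q)) := by rw [hJs, hM]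
    exact (he.1 u).trans (congrArg₂ (fun y z =>
      (u.1 + helmholtzCross hΩ q y - helmholtzCross hΩ q u.2, z)) h (hJ u.2))
  · exact (he.2 f b).trans (congrArg (fun y =>
      ((1 + woodbury (helmholtzCross hΩ q) M D) f +
        (1 + woodbury (helmholtzCross hΩ q) M D) (helmholtzCross hΩ q y), y)) (hJs b))

theorem inner_solenoidalMomentum {Ω : Set E3} (hΩ : IsBoundedC3Domain Ω)
    {N : solenoidalFields Ω 2 →L[ℝ] E3}
    (hN : ∀ v, N v = fluidMomentum Ω (v : LqField Ω 2)) (v : solenoidalFields Ω 2) (a : E3) :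
    inner ℝ (N v) a = -inner ℝ v (projCross hΩ a) := by
  rw [hN, inner_fluidMomentum_solenoidal]

/-- The reduced inertia tensor `a ↦ 𝕀 a + ∫_Ω x × ℙ (x × a) dx` is symmetric and positive
definite. -/
theorem exists_reducedInertia {Ω B : Set E3} {ρ : E3 → ℝ} (hΩ : IsBoundedC3Domain Ω)
    (hB : IsSolidBody Ω B ρ) {J : E3 ≃L[ℝ] E3} (hJ : ∀ a, J a = act (inertiaTensor Ω B ρ) a)
    {N : solenoidalFields Ω 2 →L[ℝ] E3}
    (hN : ∀ v, N v = fluidMomentum Ω (v : LqField Ω 2)) :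
    ∃ D : E3 ≃L[ℝ] E3, (∀ a, D a = J a + N (projCross hΩ a)) ∧
      (∀ a b, inner ℝ (D a) b = inner ℝ (D b) a) ∧ ∀ a, 0 ≤ inner ℝ (D a) a := by
  refine exists_equiv_eq_add_comp (inner_solenoidalMomentum hΩ hN) (J : E3 →L[ℝ] E3)
    (fun a b => ?_) (fun a ha => ?_)
  · rw [J.coe_coe, hJ, hJ, inner_act_inertiaTensor_comm]
  · rw [J.coe_coe, hJ]
    exact norm_projCross_sq_lt hΩ hB ha

/-- Both operators see their argument only through a momentum in `ℝ³`, and both use the same `D`;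
consistency thus reduces to that of the fields `w a` and `z a`. -/
theorem woodbury_ae_eq {Ω : Set E3} {q r : ℝ≥0∞} [Fact (1 ≤ q)] [Fact (1 ≤ r)]
    {w : E3 →L[ℝ] solenoidalFields Ω q} {z : E3 →L[ℝ] solenoidalFields Ω r}
    {M : solenoidalFields Ω q →L[ℝ] E3} {N : solenoidalFields Ω r →L[ℝ] E3} {D : E3 ≃L[ℝ] E3}
    (h : ∀ a, ((w a : LqField Ω q) : E3 → E3) =ᵐ[volume.restrict Ω]
      ((z a : LqField Ω r) : E3 → E3))
    {u : solenoidalFields Ω q} {v : solenoidalFields Ω r} (huv : M u = N v) :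
    ((woodbury w M D u : LqField Ω q) : E3 → E3) =ᵐ[volume.restrict Ω]
      ((woodbury z N D v : LqField Ω r) : E3 → E3) := by
  have hu : woodbury w M D u = w (-(D.symm (M u))) := (w.map_neg _).symm
  have hv : woodbury z N D v = z (-(D.symm (N v))) := (z.map_neg _).symm
  rw [hu, hv, huv]
  exact h _

theorem helmholtzCross_eq_zero {Ω : Set E3} (hΩ : IsBoundedC3Domain Ω) {q : ℝ≥0∞}
    [Fact (1 ≤ q)] (hc : ¬IsCompl (solenoidalFields Ω q) (gradientFields Ω q)) :
    helmholtzCross hΩ q = 0 := by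
  ext1 a
  rw [helmholtzCross_apply, helmholtz, dif_neg hc]
  rfl

theorem woodbury_ae_eq_zero {Ω : Set E3} {q r : ℝ≥0∞} [Fact (1 ≤ q)] [Fact (1 ≤ r)]
    {w : E3 →L[ℝ] solenoidalFields Ω q} {M : solenoidalFields Ω q →L[ℝ] E3} {D : E3 ≃L[ℝ] E3}
    (hw : w = 0) (u : solenoidalFields Ω q) (v : solenoidalFields Ω r) :
    ((woodbury w M D u : LqField Ω q) : E3 → E3) =ᵐ[volume.restrict Ω]
      (((0 : solenoidalFields Ω r →L[ℝ] solenoidalFields Ω r) v : LqField Ω r) : E3 → E3) := by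
  rw [woodbury_apply, hw, zero_apply, neg_zero, zero_apply, Submodule.coe_zero, Submodule.coe_zero]
  exact (Lp.coeFn_zero _ _ _).trans (Lp.coeFn_zero _ _ _).symm

theorem proposition3p1
    (Ω B : Set E3) (ρ : E3 → ℝ) (hΩ : IsBoundedC3Domain Ω) (hB : IsSolidBody Ω B ρ)
    (𝕀 : Matrix (Fin 3) (Fin 3) ℝ) (h𝕀 : 𝕀 = inertiaTensor Ω B ρ)
    (q : ℝ≥0∞) [Fact (1 ≤ q)] (hq₁ : 1 < q) (hq₂ : q < ⊤) :
    ∃ C : solenoidalFields Ω q →L[ℝ] solenoidalFields Ω q,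
      -- `E` is invertible on `X₀`, with the stated block-triangular inverse
      (∃ e : X0 Ω q ≃L[ℝ] X0 Ω q,
        (∀ u, e u = opE hΩ 𝕀 q u) ∧
        ∀ (f : solenoidalFields Ω q) (b : E3),
          e.symm (f, b) =
            ((1 + C) f + (1 + C) (helmholtz Ω q (crossField hΩ q (act 𝕀⁻¹ b))), act 𝕀⁻¹ b)) ∧
      -- (a) `C` is compact, in fact of finite rank
      IsCompactOperator C ∧
      FiniteDimensional ℝ (LinearMap.range (C : solenoidalFields Ω q →ₗ[ℝ] solenoidalFields Ω q)) ∧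
      -- (b) `I + C` is invertible on `L_{q,σ}(Ω)`
      IsUnit (1 + C) ∧
      -- and positive definite on `L_{2,σ}(Ω)`, where `C` acts as the bounded operator `C₂`
      ∃ C₂ : solenoidalFields Ω 2 →L[ℝ] solenoidalFields Ω 2,
        (∀ (v : solenoidalFields Ω q) (w : solenoidalFields Ω 2),
          ((v : LqField Ω q) : E3 → E3) =ᵐ[volume.restrict Ω] ((w : LqField Ω 2) : E3 → E3) →
          ((C v : LqField Ω q) : E3 → E3) =ᵐ[volume.restrict Ω]
            ((C₂ w : LqField Ω 2) : E3 → E3)) ∧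
        (∀ v w : solenoidalFields Ω 2, inner ℝ ((1 + C₂) v) w = inner ℝ v ((1 + C₂) w)) ∧
        ∃ c : ℝ, 0 < c ∧ ∀ v : solenoidalFields Ω 2, c * ‖v‖ ^ 2 ≤ inner ℝ ((1 + C₂) v) v := by
  subst h𝕀
  refine (exists_actEquiv (isUnit_inertiaTensor hΩ hB)).elim fun J hJ => ?_
  refine (exists_solenoidalMomentumL hΩ q).elim fun M hM => ?_
  by_cases hc : IsCompl (solenoidalFields Ω q) (gradientFields Ω q)
  · refine (exists_solenoidalMomentumL hΩ 2).elim fun N hN => ?_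
    have hNw := inner_solenoidalMomentum hΩ hN
    refine (exists_reducedInertia hΩ hB hJ.1 hN).elim fun D hD => ?_
    have hae := helmholtzCross_ae_eq_projCross hΩ hq₂ hc
    -- `D` was built at exponent `2`, but the momentum depends only on the a.e. class of `ℙ (x ×
    -- a)`, so the same `D` serves at exponent `q`.
    have hDq : ∀ a, D a = J a + M (helmholtzCross hΩ q a) := fun a =>
      (hD.1 a).trans (congrArg (J a + ·)
        ((hN _).trans ((fluidMomentum_congr (hae a)).symm.trans (hM _).symm)))
    refine ⟨woodbury (helmholtzCross hΩ q) M D, exists_opE_equiv hΩ q hJ.1 hJ.2 hM hDq,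
      isCompactOperator_woodbury, finiteDimensional_range_woodbury,
      isUnit_one_add_woodbury hDq, woodbury (projCross hΩ) N D, fun v w hvw => ?_,
      inner_one_add_woodbury_comm hNw hD.2.1, 1, one_pos, fun v => ?_⟩
    · exact woodbury_ae_eq hae ((hM v).trans ((fluidMomentum_congr hvw).trans (hN w).symm))
    · exact (one_mul (‖v‖ ^ 2)).le.trans (norm_sq_le_inner_one_add_woodbury hNw hD.2.2 v)
  · -- By definition `ℙ = 0` if there is no Helmholtz decomposition; then `C = 0`.
    have hw := helmholtzCross_eq_zero hΩ hc
    -- With `w = 0`, the map `J` itself plays the role of `D`.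
    have hDq : ∀ a, J a = J a + M (helmholtzCross hΩ q a) := fun a => by
      rw [hw, zero_apply, map_zero, add_zero]
    refine ⟨woodbury (helmholtzCross hΩ q) M J, exists_opE_equiv hΩ q hJ.1 hJ.2 hM hDq,
      isCompactOperator_woodbury, finiteDimensional_range_woodbury,
      isUnit_one_add_woodbury hDq, 0, fun v w _ => woodbury_ae_eq_zero hw v w,
      inner_one_add_zero_comm, 1, one_pos, fun v => ?_⟩
    exact (one_mul (‖v‖ ^ 2)).le.trans (norm_sq_le_inner_one_add_zero v)
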